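/- **Theorem 3.8 (Stroboscopic Lemma for RFDEs).** This is a statement of nonstandard analysis, in the language of Internal Set Theory, read in ultrapowers: it is asserted for every ultrafilter $U$ on every index set. The objects of the nonstandard universe are the germs (classes modulo $U$) of families of ordinary objects. The standard objects are the germs of constant families. Ordinary functions, relations and operations act on germs componentwise. Variables over reals range over all germs of families of reals, a subset of $\mathbb{R}$ is a germ of subsets of $\mathbb{R}$, and a function is a germ of functions. A vector $v$ of a standard normed space is *infinitesimal* if $\|v\|<a$ for every standard real $a>0$, and *limited* if $\|v\|\le a$ for some standard real $a>0$. Write $u\simeq v$ if $u-v$ is infinitesimal. Let $r\ge 0$ be a standard real, let $\mathbb{R}^d$ ($d$ standard) carry a standard norm $|\cdot|$, and let $\mathcal{C}=\mathcal{C}([-r,0],\mathbb{R}^d)$ be the Banach space of continuous functions with the supremum norm. For a function $x$ whose domain contains $[t-r,t]$ put $x_t(\theta)=x(t+\theta)$, $\theta\in[-r,0]$. Let $\phi\in\mathcal{C}$ be standard and let $F:[0,\infty)\times\mathcal{C}\to\mathbb{R}^d$ be standard and continuous. Let $I\subset\mathbb{R}$ and $x:I\to\mathbb{R}^d$ be a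 set and a function, not necessarily standard, such that $[-r,0]\subset I$, $x_t\in\mathcal{C}$ for every $t\ge 0$ with $[0,t]\subset I$, and $x_0\simeq\phi$. The function $x$ has the *$F$-stroboscopic property* if there exists a real $\mu>0$ such that, for every limited $t\ge 0$ in $I$ for which $[0,t]\subset I$ and both $x(s)$ and $F(s,x_s)$ are limited for all $s\in[0,t]$, there exists $t'\in I$ such that $$\mu<t'-t\simeq 0,\qquad [t,t']\subset I,\qquad x(s)\simeq x(t)\ \text{ for all } s\in[t,t'],\qquad \frac{x(t')-x(t)}{t'-t}\simeq F(t,x_t).$$ Consider the initial value problem $$\dot y(t)=F(t,y_t)\quad(t\ge 0),\qquad y_0=\phi. \tag{1}$$ A solution of (1) on $[-r,b)$, $0<b\le\infty$, is a continuous function $y:[-r,b)\to\mathbb{R}^d$ with $y_0=\phi$ that satisfies $\dot y(t)=F(t,y_t)$ for all $t\in[0,b)$ (right derivative at $t=0$). Suppose that - (a) the function $x$ has the $F$-stroboscopic property; - (b) problem (1) has a unique solution $y$, with maximal interval of definition $J=[-r,\omega)$, $0<\omega\le\infty$; that is, $y$ is a solution on $[-r,\omega)$, every solution of (1) agrees with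 $y$ wherever both are defined, and no solution of (1) that extends $y$ is defined on a larger interval. Then, for every standard $L\in J$ with $L>0$, we have $[-r,L]\subset I$, and $x(t)\simeq y(t)$ for all $t\in[-r,L]$. -/

import Mathlib

/-!
Nonstandard analysis is interpreted in ultrapowers. Fix an ultrafilter `U` on an index type `ι`.
For a (standard) type `X`, the objects of type `X` of the nonstandard universe are the germs
`Germ U X`; the standard ones among them are the constant germs `↑a`, `a : X`. A standard function
(or relation) acts on germs through `Germ.map`, `Germ.map₂` (or `Germ.LiftRel`). A real number of
the nonstandard universe is a germ of reals, a set of reals is a germ of sets of reals, and a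
function of reals is a germ of functions. Quantifiers over reals range over all germs. The
ultrafilter is arbitrary, so every ultrapower is covered, in particular those over the adequate
ultrafilters, in which idealization holds for bounded sets.
-/

open Filter

noncomputable section

namespace Strobo

/-- The objects of type `X` in the nonstandard universe given by the ultrafilter `U`. -/
abbrev Star {ι : Type*} (U : Ultrafilter ι) (X : Type*) : Type _ := Germ (U : Filter ι) X

section Nonstandard

variable {ι : Type*} {U : Ultrafilter ι} {V : Type*} [NormedAddCommGroup V]

/-- The norm of a vector of the nonstandard universe. -/
def starNorm (v : Star U V) : Star U ℝ := v.map (fun w => ‖w‖)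

/-- A vector is infinitesimal if its norm is smaller than every standard positive real. -/
def Infinitesimal (v : Star U V) : Prop :=
  ∀ a : ℝ, 0 < a → starNorm v < (↑a : Star U ℝ)

/-- A vector is limited if its norm is at most some standard positive real. -/
def Limited (v : Star U V) : Prop :=
  ∃ a : ℝ, 0 < a ∧ starNorm v ≤ (↑a : Star U ℝ)

/-- `u ≃ v`. -/
def Near (u v : Star U V) : Prop := Infinitesimal (u - v)

/-- Membership in a set of reals of the nonstandard universe. -/
def Mem (t : Star U ℝ) (I : Star U (Set ℝ)) : Prop :=
  Germ.LiftRel (fun (s : ℝ) (A : Set ℝ) => s ∈ A) t I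

/-- `[a, b] ⊆ I`, in the nonstandard universe. -/
def IccSubset (a b : Star U ℝ) (I : Star U (Set ℝ)) : Prop :=
  ∀ s : Star U ℝ, a ≤ s → s ≤ b → Mem s I

/-- The value `x(t)`, in the nonstandard universe. -/
def app (x : Star U (ℝ → V)) (t : Star U ℝ) : Star U V :=
  Germ.map₂ (fun (f : ℝ → V) (s : ℝ) => f s) x t

end Nonstandard

variable {E : Type*} [NormedAddCommGroup E] [NormedSpace ℝ E]

/-- The Banach space `𝒞 = 𝒞([-r, 0], E)` with the supremum norm. -/
abbrev Hist (r : ℝ) (E : Type*) [NormedAddCommGroup E] : Type _ := C(Set.Icc (-r) (0 : ℝ), E)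

/-- `x_t` belongs to `𝒞`: the function `θ ↦ x (t + θ)` is continuous on `[-r, 0]`. -/
def HasHist (r : ℝ) (x : ℝ → E) (t : ℝ) : Prop := ContinuousOn x (Set.Icc (t - r) t)

open Classical in
/-- The element `x_t` of `𝒞`, `x_t(θ) = x(t + θ)` for `θ ∈ [-r, 0]`
(with the junk value `0` if that function is not continuous). -/
def hist (r : ℝ) (x : ℝ → E) (t : ℝ) : Hist r E :=
  if h : HasHist r x t then
    ⟨fun θ => x (t + θ), h.comp_continuous (by fun_prop) fun θ => by
      obtain ⟨θ, h1, h2⟩ := θ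
      exact ⟨by simp only; linarith, by simp only; linarith⟩⟩
  else 0

/-- `y : [-r, b) → E`, where `0 < b ≤ ∞`, is a solution of `y'(t) = F(t, y_t)`, `y_0 = φ`:
it is continuous, it has initial segment `φ`, and it satisfies the equation on `[0, b)`
(with the right derivative at `0`). Only the values of `y` on `[-r, b)` matter. -/
structure IsSolution (r : ℝ) (F : ℝ → Hist r E → E) (φ : Hist r E) (y : ℝ → E) (b : EReal) :
    Prop where
  pos : 0 < b
  cont : ContinuousOn y {t : ℝ | -r ≤ t ∧ (t : EReal) < b}
  init : hist r y 0 = φ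
  deriv : ∀ t : ℝ, 0 ≤ t → (t : EReal) < b →
    HasDerivWithinAt y (F t (hist r y t)) {s : ℝ | 0 ≤ s ∧ (s : EReal) < b} t

/-- The initial value problem has the unique solution `y`, with maximal interval of definition
`[-r, ω)`: `y` is a solution on `[-r, ω)`, every solution coincides with `y` wherever both are
defined, and no solution that extends `y` is defined on a larger interval. -/
structure IsUniqueSolution (r : ℝ) (F : ℝ → Hist r E → E) (φ : Hist r E) (y : ℝ → E) (ω : EReal) :
    Prop where
  sol : IsSolution r F φ y ω
  unique : ∀ (z : ℝ → E) (b : EReal), IsSolution r F φ z b →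
    ∀ t : ℝ, -r ≤ t → (t : EReal) < b → (t : EReal) < ω → z t = y t
  maximal : ∀ (z : ℝ → E) (b : EReal), IsSolution r F φ z b →
    (∀ t : ℝ, -r ≤ t → (t : EReal) < ω → z t = y t) → b ≤ ω

section Property

variable {ι : Type*} {U : Ultrafilter ι}

/-- `x_t ∈ 𝒞`, in the nonstandard universe. -/
def StarHasHist (r : ℝ) (x : Star U (ℝ → E)) (t : Star U ℝ) : Prop :=
  Germ.LiftRel (HasHist r) x t

/-- The segment `x_t`, in the nonstandard universe. -/
def starHist (r : ℝ) (x : Star U (ℝ → E)) (t : Star U ℝ) : Star U (Hist r E) :=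
  Germ.map₂ (hist r) x t

/-- The value `F(t, x_t)` of the standard function `F`, in the nonstandard universe. -/
def starF {r : ℝ} (F : ℝ → Hist r E → E) (x : Star U (ℝ → E)) (t : Star U ℝ) : Star U E :=
  Germ.map₂ F t (starHist r x t)

/-- The `F`-stroboscopic property of a function `x : I → E` of the nonstandard universe
(only the values of `x` on `I` matter). -/
def Stroboscopic {r : ℝ} (F : ℝ → Hist r E → E) (I : Star U (Set ℝ)) (x : Star U (ℝ → E)) : Prop :=
  ∃ μ : Star U ℝ, 0 < μ ∧
    ∀ t : Star U ℝ, Limited t → 0 ≤ t → Mem t I → IccSubset 0 t I →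
      (∀ s : Star U ℝ, 0 ≤ s → s ≤ t → Limited (app x s) ∧ Limited (starF F x s)) →
      ∃ t' : Star U ℝ, Mem t' I ∧ μ < t' - t ∧ Near t' t ∧ IccSubset t t' I ∧
        (∀ s : Star U ℝ, t ≤ s → s ≤ t' → Near (app x s) (app x t)) ∧
        Near ((t' - t)⁻¹ • (app x t' - app x t)) (starF F x t)

end Property

end Strobo

end

namespace Strobo

open Set Topology

variable {E : Type*} [NormedAddCommGroup E]

/-! The stroboscopic property says that `x` advances like an Euler polygon for (1), by infinitesimal
steps of slope nearly `F t (x_t)`. The core is a standard statement, `exists_forall_norm_sub_le`: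
for each `η` there are standard `K` and `δ` such that any function with such `δ`-accurate steps
while bounded by `K` stays `η`-close to `y` up to `L`.

It rests on compactness and uniqueness. If closeness failed for every `δ`, counterexamples with `δ →
0` would be almost equi-Lipschitz, hence have a uniform limit (`exists_uniform_limit`). A mean value
inequality for steps makes that limit a solution (`isSolution_of_uniform_limit`), hence equal to
`y`: a contradiction. A bootstrap then supplies the bound on the slopes and pushes the domain up to
`L`.

The nonstandard theorem follows by applying the standard one to almost every representative, since
`K` and `δ` are standard. -/

/-! ### Segments of functions -/

theorem hist_apply {r t : ℝ} {x : ℝ → E} (h : HasHist r x t) (θ : Set.Icc (-r) (0 : ℝ)) :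
    hist r x t θ = x (t + θ) := by
  simp [hist, h]

theorem norm_hist_sub_le {r s t c : ℝ} {x y : ℝ → E} (hx : HasHist r x s) (hy : HasHist r y t)
    (hc : 0 ≤ c) (h : ∀ θ ∈ Set.Icc (-r) (0 : ℝ), ‖x (s + θ) - y (t + θ)‖ ≤ c) :
    ‖hist r x s - hist r y t‖ ≤ c := by
  refine (ContinuousMap.norm_le _ hc).2 fun θ => ?_
  rw [ContinuousMap.sub_apply, hist_apply hx, hist_apply hy]
  exact h θ θ.2

theorem HasHist.of_continuousOn {r L t : ℝ} {x : ℝ → E} (h : ContinuousOn x (Icc (-r) L))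
    (ht : t ∈ Icc 0 L) : HasHist r x t :=
  h.mono fun s hs => ⟨by linarith [hs.1, ht.1], hs.2.trans ht.2⟩

/-! ### Functions that progress by steps -/

/-- A step of length between `μ` and `δ` from `t`, along which `x` moves by at most `δ` and whose
slope is `G t` up to `δ`. -/
def HasStep [NormedSpace ℝ E] (G x : ℝ → E) (I : Set ℝ) (μ δ t : ℝ) : Prop :=
  ∃ t', μ < t' - t ∧ t' - t ≤ δ ∧ Icc t t' ⊆ I ∧ (∀ s ∈ Icc t t', ‖x s - x t‖ ≤ δ) ∧
    ‖(t' - t)⁻¹ • (x t' - x t) - G t‖ ≤ δ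

/-- Mean value inequality for functions that progress by steps. -/
theorem norm_sub_sub_smul_le_of_hasStep [NormedSpace ℝ E] {G x : ℝ → E} {I : Set ℝ} {μ δ ε a b : ℝ} {v : E}
    (hμ : 0 < μ) (hab : a ≤ b) (hε : 0 ≤ ε) (hδ : 0 ≤ δ)
    (h : ∀ t ∈ Ico a b, HasStep G x I μ δ t) (hG : ∀ t ∈ Ico a b, ‖G t - v‖ ≤ ε) :
    ‖x b - x a - (b - a) • v‖ ≤ (ε + δ) * (b - a) + δ * (1 + ‖v‖) := by
  -- Each step exceeds `μ`, so at most `n` of them reach `b`. The bound itself does not involve `μ`,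
  -- which may be arbitrarily small.
  obtain ⟨n, hn⟩ := exists_nat_ge ((b - a) / μ)
  rw [div_le_iff₀ hμ] at hn
  induction n generalizing a with
  | zero =>
    have : a = b := le_antisymm hab (by simp at hn; linarith)
    subst this
    simp only [sub_self, zero_smul, norm_zero, mul_zero, zero_add]
    positivity
  | succ n ih =>
    rcases hab.eq_or_lt with rfl | hlt
    · simp only [sub_self, zero_smul, norm_zero, mul_zero, zero_add]
      positivity
    obtain ⟨t', h1, h2, -, h4, h5⟩ := h a ⟨le_rfl, hlt⟩
    rcases le_or_gt b t' with hb | hb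
    -- The last step overshoots `b`, so its slope says nothing at `b`; its small length and
    -- oscillation cost `δ * (1 + ‖v‖)`, paid only once.
    · have e1 := h4 b ⟨hab, hb⟩
      have e2 : ‖(b - a) • v‖ ≤ δ * ‖v‖ := by
        rw [norm_smul, Real.norm_of_nonneg (by linarith)]
        gcongr
        linarith
      have e3 : 0 ≤ (ε + δ) * (b - a) := mul_nonneg (by linarith) (by linarith)
      have := norm_sub_le (x b - x a) ((b - a) • v)
      linarith
    · have hat : a ≤ t' := by linarith
      have e1 := ih hb.le (fun t ht => h t ⟨hat.trans ht.1, ht.2⟩)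
        (fun t ht => hG t ⟨hat.trans ht.1, ht.2⟩) (by push_cast at hn; linarith)
      have hpos : 0 < t' - a := by linarith
      have e2 : ‖x t' - x a - (t' - a) • v‖ ≤ (ε + δ) * (t' - a) := by
        have e : x t' - x a - (t' - a) • v =
            (t' - a) • (((t' - a)⁻¹ • (x t' - x a) - G a) + (G a - v)) := by
          rw [sub_add_sub_cancel, smul_sub, smul_inv_smul₀ hpos.ne']
        rw [e, norm_smul, Real.norm_of_nonneg hpos.le, mul_comm]
        gcongr
        exact (norm_add_le _ _).trans (by linarith [hG a ⟨le_rfl, hlt⟩])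
      have e3 : x b - x a - (b - a) • v =
          (x b - x t' - (b - t') • v) + (x t' - x a - (t' - a) • v) := by
        module
      rw [e3]
      refine (norm_add_le _ _).trans ?_
      linarith

/-! ### Continuity and local boundedness of `F` along segments -/

/-- The segments of a continuous function depend continuously on time. -/
theorem exists_norm_hist_sub_le {r L : ℝ} {y : ℝ → E} (hy : ContinuousOn y (Icc (-r) L))
    {κ : ℝ} (hκ : 0 < κ) : ∃ h > 0, ∀ s ∈ Icc 0 L, ∀ t ∈ Icc 0 L, |s - t| < h →
      ∀ θ ∈ Icc (-r) 0, ‖y (s + θ) - y (t + θ)‖ ≤ κ := by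
  obtain ⟨h, h0, H⟩ := Metric.uniformContinuousOn_iff.1
    (isCompact_Icc.uniformContinuousOn_of_continuous hy) κ hκ
  refine ⟨h, h0, fun s hs t ht hst θ hθ => ?_⟩
  rw [← dist_eq_norm]
  refine (H _ ⟨by linarith [hs.1, hθ.1], by linarith [hs.2, hθ.2]⟩ _
    ⟨by linarith [ht.1, hθ.1], by linarith [ht.2, hθ.2]⟩ ?_).le
  rwa [Real.dist_eq, add_sub_add_right_eq_sub]

/-- Quantitative continuity of `F` on `[0, ∞) × 𝒞`. -/
theorem exists_norm_sub_lt {r : ℝ} {F : ℝ → Hist r E → E}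
    (hF : ContinuousOn (Function.uncurry F) (Ici (0 : ℝ) ×ˢ univ)) {t : ℝ} (ht : 0 ≤ t)
    (u : Hist r E) {ε : ℝ} (hε : 0 < ε) :
    ∃ κ > 0, ∀ s, 0 ≤ s → |s - t| < κ → ∀ w : Hist r E, ‖w - u‖ < κ → ‖F s w - F t u‖ < ε := by
  obtain ⟨κ, hκ, H⟩ := Metric.continuousOn_iff.1 hF (t, u) ⟨ht, mem_univ _⟩ ε hε
  refine ⟨κ, hκ, fun s hs hst w hw => ?_⟩
  have := H (s, w) ⟨hs, mem_univ _⟩ (by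
    rw [Prod.dist_eq, max_lt_iff, Real.dist_eq, dist_eq_norm]
    exact ⟨hst, hw⟩)
  rwa [dist_eq_norm] at this

/-- `F` is bounded near the segments of a continuous function over a compact interval. -/
theorem exists_bound_near_hist {r : ℝ} {F : ℝ → Hist r E → E}
    (hF : ContinuousOn (Function.uncurry F) (Ici (0 : ℝ) ×ˢ univ)) {L : ℝ} {y : ℝ → E}
    (hy : ContinuousOn y (Icc (-r) L)) :
    ∃ ρ > 0, ∃ M, ∀ s ∈ Icc 0 L, ∀ u : Hist r E, ‖u - hist r y s‖ ≤ ρ → ‖F s u‖ ≤ M := by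
  refine isCompact_Icc.induction_on
    (p := fun A => ∃ ρ > 0, ∃ M, ∀ s ∈ A, ∀ u : Hist r E, ‖u - hist r y s‖ ≤ ρ → ‖F s u‖ ≤ M)
    ⟨1, one_pos, 0, fun s hs => hs.elim⟩ ?_ ?_ ?_
  · rintro A B hAB ⟨ρ, hρ, M, H⟩
    exact ⟨ρ, hρ, M, fun s hs => H s (hAB hs)⟩
  · rintro A B ⟨ρ, hρ, M, H⟩ ⟨ρ', hρ', M', H'⟩
    refine ⟨min ρ ρ', lt_min hρ hρ', max M M', fun s hs u hu => ?_⟩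
    rcases hs with hs | hs
    · exact (H s hs u (hu.trans (min_le_left _ _))).trans (le_max_left _ _)
    · exact (H' s hs u (hu.trans (min_le_right _ _))).trans (le_max_right _ _)
  · intro t ht
    obtain ⟨κ, hκ, Hκ⟩ := exists_norm_sub_lt hF ht.1 (hist r y t) one_pos
    obtain ⟨h, h0, Hh⟩ := exists_norm_hist_sub_le hy (half_pos hκ)
    refine ⟨Icc 0 L ∩ Metric.ball t (min h κ), inter_mem_nhdsWithin _
      (Metric.ball_mem_nhds _ (lt_min h0 hκ)), κ / 3, by positivity,
      ‖F t (hist r y t)‖ + 1, fun s hs u hu => ?_⟩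
    have hst := hs.2
    rw [Metric.mem_ball, Real.dist_eq, lt_min_iff] at hst
    have e1 : ‖hist r y s - hist r y t‖ ≤ κ / 2 :=
      norm_hist_sub_le (.of_continuousOn hy hs.1) (.of_continuousOn hy ht) (by positivity)
        (Hh s hs.1 t ht hst.1)
    have e2 := Hκ s hs.1.1 hst.2 u (by
      have := norm_sub_le_norm_sub_add_norm_sub u (hist r y s) (hist r y t)
      linarith)
    have := norm_sub_norm_le (F s u) (F t (hist r y t))
    linarith

/-! ### Limits along an ultrafilter -/

/-- Almost equi-Lipschitz functions on the intervals `[0, T n]` with converging initial segments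
converge uniformly along an ultrafilter. -/
theorem exists_uniform_limit [NormedSpace ℝ E] [FiniteDimensional ℝ E] {ι : Type*}
    (V : Ultrafilter ι) {r L M : ℝ}
    (hr : 0 ≤ r) (hL : 0 ≤ L) (hM : 0 ≤ M) {x : ι → ℝ → E} {y : ℝ → E} {T e : ι → ℝ}
    (hy : ContinuousOn y (Icc (-r) 0)) (hT : ∀ n, T n ∈ Icc 0 L) (he : Tendsto e V (𝓝 0))
    (hxy : ∀ n, ∀ s ∈ Icc (-r) 0, ‖x n s - y s‖ ≤ e n)
    (hx : ∀ n a b, 0 ≤ a → a ≤ b → b ≤ T n → ‖x n b - x n a‖ ≤ M * (b - a) + e n) :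
    ∃ z : ℝ → E, ContinuousOn z (Icc (-r) L) ∧ (∀ s ∈ Icc (-r) 0, z s = y s) ∧
      ∀ ε > 0, ∀ᶠ n in V, ∀ t ∈ Icc (-r) (T n), ‖x n t - z t‖ ≤ ε := by
  have : ProperSpace E := FiniteDimensional.proper ℝ E
  have hsmall : ∀ ε > 0, ∀ᶠ n in V, e n < ε := fun ε hε => he.eventually_lt_const hε
  -- Freezing `x n` after `T n` keeps the Lipschitz estimate and puts all functions on the same
  -- interval.
  set w : ι → ℝ → E := fun n t => x n (min t (T n)) with hw
  have hwx : ∀ n t, t ≤ T n → w n t = x n t := fun n t ht => by simp only [hw, min_eq_left ht]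
  have hlip : ∀ n, ∀ a ∈ Icc 0 L, ∀ b ∈ Icc 0 L, ‖w n b - w n a‖ ≤ M * |b - a| + e n := by
    have key : ∀ n a b, 0 ≤ a → a ≤ b → ‖w n b - w n a‖ ≤ M * (b - a) + e n := by
      intro n a b ha hab
      refine (hx n (min a (T n)) (min b (T n)) (le_min ha (hT n).1)
        (min_le_min_right _ hab) (min_le_right _ _)).trans ?_
      have : min b (T n) - min a (T n) ≤ b - a := by
        rcases le_total b (T n) with h1 | h1
        · rw [min_eq_left h1, min_eq_left (hab.trans h1)]
        · rw [min_eq_right h1]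
          rcases le_total a (T n) with h2 | h2
          · rw [min_eq_left h2]; linarith
          · rw [min_eq_right h2]; linarith
      gcongr
    intro n a ha b hb
    rcases le_total a b with h | h
    · rw [abs_of_nonneg (by linarith)]
      exact key n a b ha.1 h
    · rw [norm_sub_rev, abs_sub_comm, abs_of_nonneg (by linarith)]
      exact key n b a hb.1 h
  have hinit : ∀ n, ∀ s ∈ Icc (-r) 0, ‖w n s - y s‖ ≤ e n := by
    intro n s hs
    rw [hwx n s (hs.2.trans (hT n).1)]
    exact hxy n s hs
  have hlim : ∀ t ∈ Icc 0 L, ∃ p, Tendsto (fun n => w n t) V (𝓝 p) := by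
    intro t ht
    have hb : ∀ᶠ n in V, w n t ∈ Metric.closedBall (y 0) (M * L + 2) := by
      filter_upwards [hsmall 1 one_pos] with n hn
      have e1 := hlip n 0 ⟨le_rfl, hL⟩ t ht
      have e2 := hinit n 0 ⟨by linarith, le_rfl⟩
      have e3 : M * |t - 0| ≤ M * L := by
        rw [sub_zero, abs_of_nonneg ht.1]
        exact mul_le_mul_of_nonneg_left ht.2 hM
      rw [Metric.mem_closedBall, dist_eq_norm]
      have := norm_sub_le_norm_sub_add_norm_sub (w n t) (w n 0) (y 0)
      linarith
    -- In a compact ball every ultrafilter converges, so no subsequence is extracted.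
    obtain ⟨p, -, hp⟩ := (isCompact_closedBall (y 0) (M * L + 2)).ultrafilter_le_nhds
      (V.map fun n => w n t) (le_principal_iff.2 hb)
    exact ⟨p, hp⟩
  have hlim0 : ∀ t ∈ Icc (-r) 0, Tendsto (fun n => w n t) V (𝓝 (y t)) := fun t ht =>
    tendsto_iff_norm_sub_tendsto_zero.2
      (squeeze_zero (fun _ => norm_nonneg _) (fun n => hinit n t ht) he)
  have hex : ∀ t, ∃ p, t ∈ Icc (-r) L → Tendsto (fun n => w n t) V (𝓝 p) := by
    intro t
    by_cases ht : t ∈ Icc (-r) L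
    · rcases le_total t 0 with h0 | h0
      · exact ⟨y t, fun _ => hlim0 t ⟨ht.1, h0⟩⟩
      · exact (hlim t ⟨h0, ht.2⟩).imp fun p hp _ => hp
    · exact ⟨0, fun h => absurd h ht⟩
  choose z hz using hex
  have hzy : ∀ s ∈ Icc (-r) 0, z s = y s := fun s hs =>
    tendsto_nhds_unique (hz s ⟨hs.1, hs.2.trans hL⟩) (hlim0 s hs)
  have hz' : ∀ t ∈ Icc 0 L, Tendsto (fun n => w n t) V (𝓝 (z t)) := fun t ht =>
    hz t ⟨by linarith [ht.1], ht.2⟩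
  have hzlip : ∀ a ∈ Icc 0 L, ∀ b ∈ Icc 0 L, ‖z b - z a‖ ≤ M * |b - a| := by
    intro a ha b hb
    have h2 : Tendsto (fun n => M * |b - a| + e n) V (𝓝 (M * |b - a| + 0)) := he.const_add _
    rw [add_zero] at h2
    exact le_of_tendsto_of_tendsto' ((hz' b hb).sub (hz' a ha)).norm h2
      fun n => hlip n a ha b hb
  have hzc : ContinuousOn z (Icc 0 L) := by
    refine LipschitzOnWith.continuousOn (K := ⟨M, hM⟩) (.of_dist_le_mul fun a ha b hb => ?_)
    rw [dist_eq_norm, Real.dist_eq]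
    exact hzlip b hb a ha
  refine ⟨z, ?_, hzy, ?_⟩
  · rw [← Icc_union_Icc_eq_Icc (b := 0) (by linarith) hL]
    exact (hy.congr hzy).union_of_isClosed hzc isClosed_Icc isClosed_Icc
  · intro ε hε
    have hunif : ∀ᶠ n in V, ∀ t ∈ Icc 0 L, ‖w n t - z t‖ ≤ ε := by
      refine isCompact_Icc.induction_on (p := fun A => ∀ᶠ n in V, ∀ t ∈ A, ‖w n t - z t‖ ≤ ε)
        (Eventually.of_forall fun n t ht => ht.elim)
        (fun A B hAB h => h.mono fun n hn t ht => hn t (hAB ht))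
        (fun A B hA hB => ?_) fun t ht => ?_
      · filter_upwards [hA, hB] with n h1 h2 t ht using ht.elim (h1 t) (h2 t)
      -- Four errors of `ε / 4`: the Lipschitz parts of `w n` and `z`, the defect `e n`, and
      -- convergence at `t`. The `M + 1` allows `M = 0`.
      · refine ⟨Icc 0 L ∩ Metric.ball t (ε / (4 * (M + 1))), inter_mem_nhdsWithin _
          (Metric.ball_mem_nhds _ (by positivity)), ?_⟩
        filter_upwards [hsmall (ε / 4) (by positivity),
          (tendsto_iff_norm_sub_tendsto_zero.1 (hz' t ht)).eventually_lt_const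
            (show 0 < ε / 4 by positivity)] with n h1 h2 s hs
        have h3 : M * |s - t| ≤ ε / 4 := by
          have := hs.2
          rw [Metric.mem_ball, Real.dist_eq] at this
          calc M * |s - t| ≤ (M + 1) * (ε / (4 * (M + 1))) := by gcongr; linarith
            _ = ε / 4 := by field_simp
        have h4 := hlip n t ht s hs.1
        have h5 := hzlip s hs.1 t ht
        rw [abs_sub_comm] at h5
        have h6 := norm_sub_le_norm_sub_add_norm_sub (w n s) (w n t) (z s)
        have h7 := norm_sub_le_norm_sub_add_norm_sub (w n t) (z t) (z s)
        linarith
    filter_upwards [hunif, hsmall ε hε] with n h1 h2 t ht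
    rcases le_total t 0 with h0 | h0
    · rw [hzy t ⟨ht.1, h0⟩]
      exact (hxy n t ⟨ht.1, h0⟩).trans h2.le
    · rw [← hwx n t ht.2]
      exact h1 t ⟨h0, ht.2.trans (hT n).2⟩

/-- A uniform limit of functions that progress by shorter and shorter steps of slopes
`F t (x_t)` is a solution. -/
theorem isSolution_of_uniform_limit [NormedSpace ℝ E] {ι : Type*} (V : Ultrafilter ι)
    {r L S : ℝ} (hr : 0 ≤ r) {F : ℝ → Hist r E → E}
    (hF : ContinuousOn (Function.uncurry F) (Ici (0 : ℝ) ×ˢ univ)) {φ : Hist r E}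
    {x : ι → ℝ → E} {I : ι → Set ℝ} {T μ δ : ι → ℝ} {z : ℝ → E}
    (hδ0 : ∀ n, 0 ≤ δ n) (hδ : Tendsto δ V (𝓝 0)) (hμ : ∀ n, 0 < μ n)
    (hT : Tendsto T V (𝓝 S)) (hS : 0 < S) (hSL : S ≤ L)
    (hhist : ∀ n, ∀ t ∈ Icc 0 (T n), HasHist r (x n) t)
    (hstep : ∀ n, ∀ t ∈ Ico 0 (T n),
      HasStep (fun s => F s (hist r (x n) s)) (x n) (I n) (μ n) (δ n) t)
    (hzc : ContinuousOn z (Icc (-r) L)) (hz0 : hist r z 0 = φ)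
    (hxz : ∀ ε > 0, ∀ᶠ n in V, ∀ t ∈ Icc (-r) (T n), ‖x n t - z t‖ ≤ ε) :
    IsSolution r F φ z S := by
  refine ⟨by exact_mod_cast hS, hzc.mono fun t ht => ⟨ht.1, ?_⟩, hz0, fun t ht0 htS => ?_⟩
  · exact (EReal.coe_lt_coe_iff.1 ht.2).le.trans hSL
  replace htS : t < S := EReal.coe_lt_coe_iff.1 htS
  set v := F t (hist r z t) with hv
  have htL : t ∈ Icc 0 L := ⟨ht0, htS.le.trans hSL⟩
  rw [hasDerivWithinAt_iff_isLittleO, Asymptotics.isLittleO_iff]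
  intro ε hε
  obtain ⟨κ, hκ, Hκ⟩ := exists_norm_sub_lt hF ht0 (hist r z t) hε
  obtain ⟨h, h0, Hh⟩ := exists_norm_hist_sub_le hzc (half_pos hκ)
  obtain ⟨η, hη, hη1⟩ : ∃ η > 0, η < min (min h κ) (S - t) :=
    exists_between (lt_min (lt_min h0 hκ) (by linarith))
  simp only [lt_min_iff] at hη1
  obtain ⟨⟨hηh, hηκ⟩, hηS⟩ := hη1
  have hlim : ∀ p, p ∈ Ico (-r) S → Tendsto (fun n => x n p) V (𝓝 (z p)) := by
    intro p hp
    rw [tendsto_iff_norm_sub_tendsto_zero, Metric.tendsto_nhds]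
    intro c hc
    filter_upwards [hxz (c / 2) (by positivity), hT.eventually_const_lt hp.2] with n h1 h2
    rw [Real.dist_eq, sub_zero, abs_norm]
    linarith [h1 p ⟨hp.1, h2.le⟩]
  -- Near `t` the slopes along `x n` are within `ε` of `v`, so the mean value inequality for steps
  -- applies; all its `δ n` terms vanish in the limit.
  have key : ∀ a b, 0 ≤ a → a ≤ b → |a - t| ≤ η → |b - t| ≤ η →
      ‖z b - z a - (b - a) • v‖ ≤ ε * (b - a) := by
    intro a b ha hab hat hbt
    have hat' := abs_le.1 hat
    have hbt' := abs_le.1 hbt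
    have hbS : b < S := by linarith
    have hR : Tendsto (fun n => (ε + δ n) * (b - a) + δ n * (1 + ‖v‖)) V (𝓝 (ε * (b - a))) := by
      have := ((hδ.const_add ε).mul_const (b - a)).add (hδ.mul_const (1 + ‖v‖))
      simpa using this
    refine le_of_tendsto_of_tendsto
      (((hlim b ⟨by linarith, hbS⟩).sub (hlim a ⟨by linarith, by linarith⟩)).sub_const _).norm
      hR ?_
    filter_upwards [hxz (κ / 4) (by positivity), hT.eventually_const_lt hbS] with n h1 h2
    refine norm_sub_sub_smul_le_of_hasStep (G := fun s => F s (hist r (x n) s)) (hμ n) hab hε.le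
      (hδ0 n) (fun s hs => hstep n s ⟨ha.trans hs.1, hs.2.trans h2⟩) fun s hs => ?_
    have hs0 : 0 ≤ s := ha.trans hs.1
    have hsT : s ≤ T n := (hs.2.trans h2).le
    have hst : |s - t| ≤ η := abs_le.2 ⟨by linarith [hs.1], by linarith [hs.2]⟩
    have hsL : s ∈ Icc 0 L := ⟨hs0, by linarith [hs.2]⟩
    refine (Hκ s hs0 (hst.trans_lt hηκ) _ ?_).le
    refine lt_of_le_of_lt (norm_hist_sub_le (c := κ / 4 + κ / 2) (hhist n s ⟨hs0, hsT⟩)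
      (.of_continuousOn hzc htL) (by positivity) fun θ hθ => ?_) (by linarith)
    have e1 := h1 (s + θ) ⟨by linarith [hθ.1], by linarith [hθ.2]⟩
    have e2 := Hh s hsL t htL (hst.trans_lt hηh) θ hθ
    exact (norm_sub_le_norm_sub_add_norm_sub _ (z (s + θ)) _).trans (by linarith)
  filter_upwards [self_mem_nhdsWithin, mem_nhdsWithin_of_mem_nhds (Metric.ball_mem_nhds t hη)]
    with s hs hst
  rw [Metric.mem_ball, Real.dist_eq] at hst
  have htt : |t - t| ≤ η := by simpa using hη.le
  rcases le_total t s with hts | hts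
  · have := key t s ht0 hts htt hst.le
    rwa [Real.norm_of_nonneg (by linarith)]
  · have := key s t hs.1 hts hst.le htt
    rw [Real.norm_of_nonpos (show s - t ≤ 0 by linarith), neg_sub, ← norm_neg]
    refine le_of_eq_of_le ?_ this
    congr 1
    module

/-! ### The stroboscopic lemma in standard terms -/

theorem HasStep.mono [NormedSpace ℝ E] {G x : ℝ → E} {I : Set ℝ} {μ δ δ' t : ℝ}
    (h : HasStep G x I μ δ t) (hδ : δ ≤ δ') : HasStep G x I μ δ' t := by
  obtain ⟨t', h1, h2, h3, h4, h5⟩ := h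
  exact ⟨t', h1, h2.trans hδ, h3, fun s hs => (h4 s hs).trans hδ, h5.trans hδ⟩

theorem IsSolution.continuousOn_Icc [NormedSpace ℝ E] {r L : ℝ} {F : ℝ → Hist r E → E}
    {φ : Hist r E} {y : ℝ → E} {ω : EReal} (h : IsSolution r F φ y ω) (hL : (L : EReal) < ω) :
    ContinuousOn y (Icc (-r) L) :=
  h.cont.mono fun _ ht => ⟨ht.1, lt_of_le_of_lt (EReal.coe_le_coe_iff.2 ht.2) hL⟩

/-- A function that progresses by short steps of bounded slopes is close to the unique solution. -/
theorem exists_norm_sub_le_of_hasStep [NormedSpace ℝ E] [FiniteDimensional ℝ E] {r L M : ℝ}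
    (hr : 0 ≤ r) (hL : 0 ≤ L) (hM : 0 ≤ M) {F : ℝ → Hist r E → E}
    (hF : ContinuousOn (Function.uncurry F) (Ici (0 : ℝ) ×ˢ univ)) {φ : Hist r E}
    {y : ℝ → E} {ω : EReal} (hy : IsUniqueSolution r F φ y ω) (hLω : (L : EReal) < ω)
    {η : ℝ} (hη : 0 < η) :
    ∃ δ > 0, ∀ (x : ℝ → E) (I : Set ℝ) (μ T : ℝ), 0 < μ → T ∈ Icc 0 L →
      (∀ t ∈ Icc 0 T, HasHist r x t) →
      (∀ t ∈ Ico 0 T, HasStep (fun s => F s (hist r x s)) x I μ δ t) →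
      (∀ t ∈ Ico 0 T, ‖F t (hist r x t)‖ ≤ M) →
      (∀ s ∈ Icc (-r) 0, ‖x s - y s‖ ≤ δ) → ‖x T - y T‖ ≤ η := by
  by_contra! H
  choose x I μ T hμ hT hhist hstep hbd hinit hfar using
    fun n : ℕ => H (1 / ((n : ℝ) + 1)) Nat.one_div_pos_of_nat
  set V : Ultrafilter ℕ := hyperfilter ℕ
  have hV : (V : Filter ℕ) ≤ atTop := Nat.hyperfilter_le_atTop
  set δ : ℕ → ℝ := fun n => 1 / ((n : ℝ) + 1)
  have hδ0 : ∀ n, 0 ≤ δ n := fun n => Nat.one_div_pos_of_nat.le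
  have hδ : Tendsto δ V (𝓝 0) := tendsto_one_div_add_atTop_nhds_zero_nat.mono_left hV
  have hyc := hy.sol.continuousOn_Icc hLω
  obtain ⟨S, hS, hTS⟩ := (isCompact_Icc (a := 0) (b := L)).ultrafilter_le_nhds (V.map T)
    (tendsto_principal.2 (Eventually.of_forall hT))
  replace hTS : Tendsto T V (𝓝 S) := hTS
  -- With `v = 0` the mean value inequality gives the error `δ n * (b - a) + δ n`, whence `e n = δ n
  -- * (1 + L)`.
  obtain ⟨z, hzc, hzy, hxz⟩ := exists_uniform_limit V hr hL hM (x := x) (y := y) (T := T)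
    (e := fun n => δ n * (1 + L)) (hyc.mono (Icc_subset_Icc_right hL)) hT
    (by simpa using hδ.mul_const (1 + L))
    (fun n s hs => (hinit n s hs).trans (le_mul_of_one_le_right (hδ0 n) (by linarith)))
    (fun n a b ha hab hb => by
      have h1 := norm_sub_sub_smul_le_of_hasStep (v := 0) (hμ n) hab hM (hδ0 n)
        (fun t ht => hstep n t ⟨ha.trans ht.1, ht.2.trans_le hb⟩)
        (fun t ht => by
          simpa using hbd n t ⟨ha.trans ht.1, ht.2.trans_le hb⟩)
      simp only [smul_zero, sub_zero, norm_zero, add_zero, mul_one] at h1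
      have h2 : δ n * (b - a) ≤ δ n * L :=
        mul_le_mul_of_nonneg_left (by linarith [(hT n).2]) (hδ0 n)
      linarith)
  have hz0 : hist r z 0 = φ := by
    rw [← hy.sol.init, ← sub_eq_zero, ← norm_le_zero_iff]
    refine norm_hist_sub_le (.of_continuousOn hzc ⟨le_rfl, hL⟩)
      (.of_continuousOn hyc ⟨le_rfl, hL⟩) le_rfl fun θ hθ => ?_
    rw [zero_add, hzy θ hθ, sub_self, norm_zero]
  have hsub : Icc 0 L ⊆ Icc (-r) L := Icc_subset_Icc_left (by linarith)
  -- Uniqueness speaks only of times before `S`; continuity reaches `S`. If `S = 0`, the initial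
  -- data suffice.
  have hzS : z S = y S := by
    rcases hS.1.eq_or_lt with h0 | h0
    · rw [← h0]
      exact hzy 0 ⟨by linarith, le_rfl⟩
    have hsol := isSolution_of_uniform_limit V hr hF hδ0 hδ hμ hTS h0 hS.2 hhist hstep hzc hz0 hxz
    have heq : EqOn z y (Ioo 0 S) := fun t ht =>
      hy.unique z S hsol t (by linarith [ht.1]) (EReal.coe_lt_coe_iff.2 ht.2)
        (lt_of_le_of_lt (EReal.coe_le_coe_iff.2 (ht.2.le.trans hS.2)) hLω)
    have hIcc : Icc 0 S ⊆ Icc (-r) L := (Icc_subset_Icc_right hS.2).trans hsub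
    refine heq.of_subset_closure (hzc.mono hIcc) (hyc.mono hIcc) Ioo_subset_Icc_self ?_
      ⟨h0.le, le_rfl⟩
    rw [closure_Ioo h0.ne]
  have hTw : Tendsto T V (𝓝[Icc (-r) L] S) :=
    tendsto_nhdsWithin_iff.2 ⟨hTS, Eventually.of_forall fun n => hsub (hT n)⟩
  have h1 : Tendsto (fun n => z (T n) - y (T n)) V (𝓝 (z S - y S)) :=
    ((hzc S (hsub hS)).tendsto.comp hTw).sub ((hyc S (hsub hS)).tendsto.comp hTw)
  rw [hzS, sub_self] at h1
  have h2 := (tendsto_zero_iff_norm_tendsto_zero.1 h1).eventually_lt_const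
    (show 0 < η / 2 by positivity)
  obtain ⟨n, h3, h4⟩ := (h2.and (hxz (η / 2) (by positivity))).exists
  have h5 := h4 (T n) ⟨by linarith [(hT n).1], le_rfl⟩
  have := norm_sub_le_norm_sub_add_norm_sub (x n (T n)) (z (T n)) (y (T n))
  linarith [hfar n]

/-- The stroboscopic lemma in standard terms: a function that has short steps as long as it and
its slopes stay bounded exists up to `L` and is close to the unique solution. -/
theorem exists_forall_norm_sub_le [NormedSpace ℝ E] [FiniteDimensional ℝ E] {r L : ℝ}
    (hr : 0 ≤ r) (hL : 0 ≤ L) {F : ℝ → Hist r E → E}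
    (hF : ContinuousOn (Function.uncurry F) (Ici (0 : ℝ) ×ˢ univ)) {φ : Hist r E}
    {y : ℝ → E} {ω : EReal} (hy : IsUniqueSolution r F φ y ω) (hLω : (L : EReal) < ω)
    {η : ℝ} (hη : 0 < η) :
    ∃ K > 0, ∃ δ > 0, ∀ (x : ℝ → E) (I : Set ℝ) (μ : ℝ), 0 < μ → Icc (-r) 0 ⊆ I →
      (∀ t, 0 ≤ t → Icc 0 t ⊆ I → HasHist r x t) →
      (∀ s ∈ Icc (-r) 0, ‖x s - y s‖ ≤ δ) →
      (∀ t, 0 ≤ t → t ≤ K → Icc 0 t ⊆ I →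
        (∀ s ∈ Icc 0 t, ‖x s‖ ≤ K ∧ ‖F s (hist r x s)‖ ≤ K) →
        HasStep (fun s => F s (hist r x s)) x I μ δ t) →
      Icc 0 L ⊆ I ∧ ∀ s ∈ Icc (-r) L, ‖x s - y s‖ ≤ η := by
  have hyc := hy.sol.continuousOn_Icc hLω
  obtain ⟨ρ₀, hρ₀, M, hM⟩ := exists_bound_near_hist hF hyc
  obtain ⟨B, hB⟩ := isCompact_Icc.exists_bound_of_continuousOn hyc
  obtain ⟨ρ, hρ, hρρ₀, hρη⟩ : ∃ ρ > 0, ρ ≤ ρ₀ ∧ ρ ≤ η :=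
    ⟨min ρ₀ η, lt_min hρ₀ hη, min_le_left _ _, min_le_right _ _⟩
  -- Thirds of `ρ`: the error at the current time, the motion of `x` in one step, and the
  -- oscillation of `y` over that step.
  obtain ⟨δ₁, hδ₁, hclose⟩ := exists_norm_sub_le_of_hasStep hr hL (le_max_right M 0) hF hy hLω
    (show 0 < ρ / 3 by positivity)
  obtain ⟨h, h0, Hh⟩ := Metric.uniformContinuousOn_iff.1
    (isCompact_Icc.uniformContinuousOn_of_continuous hyc) (ρ / 3) (by positivity)
  obtain ⟨K, hK, hKL, hKM, hKB⟩ : ∃ K > 0, L ≤ K ∧ max M 0 ≤ K ∧ B + ρ ≤ K :=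
    ⟨max (L + 1) (max (max M 0) (B + ρ)), lt_max_of_lt_left (by linarith),
      le_max_of_le_left (by linarith), by simp, by simp⟩
  obtain ⟨δ, hδ, hδδ₁, hδρ, hδh⟩ : ∃ δ > 0, δ ≤ δ₁ ∧ δ ≤ ρ / 3 ∧ δ < h :=
    ⟨min δ₁ (min (ρ / 3) (h / 2)), by positivity, by simp, by simp,
      ((min_le_right _ _).trans (min_le_right _ _)).trans_lt (by linarith)⟩
  refine ⟨K, hK, δ, hδ, fun x I μ hμ hI hhist hinit hstep => ?_⟩
  -- Bootstrap on the number of steps left: the crude bound `ρ` on the past bounds the slopes,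
  -- `hclose` then improves it to `ρ / 3` at `t`, and one more step restores `ρ`. Errors do not
  -- accumulate.
  suffices H : ∀ n : ℕ, ∀ t ∈ Icc 0 L, L - t ≤ n * μ → Icc 0 t ⊆ I →
      (∀ s ∈ Icc (-r) t, ‖x s - y s‖ ≤ ρ) → Icc 0 L ⊆ I ∧ ∀ s ∈ Icc (-r) L, ‖x s - y s‖ ≤ ρ by
    obtain ⟨n, hn⟩ := exists_nat_ge (L / μ)
    rw [div_le_iff₀ hμ] at hn
    obtain ⟨h1, h2⟩ := H n 0 ⟨le_rfl, hL⟩ (by linarith)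
      ((Icc_subset_Icc_left (by linarith)).trans hI)
      fun s hs => (hinit s hs).trans (by linarith)
    exact ⟨h1, fun s hs => (h2 s hs).trans hρη⟩
  intro n
  induction n with
  | zero =>
    intro t ht hLt h1 h2
    have : t = L := le_antisymm ht.2 (by simp at hLt; linarith)
    subst this
    exact ⟨h1, h2⟩
  | succ n ih =>
    intro t ht hLt h1 h2
    have hh : ∀ s ∈ Icc 0 t, HasHist r x s := fun s hs =>
      hhist s hs.1 ((Icc_subset_Icc_right hs.2).trans h1)
    have hFM : ∀ s ∈ Icc 0 t, ‖F s (hist r x s)‖ ≤ max M 0 := fun s hs =>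
      le_max_of_le_left (hM s ⟨hs.1, hs.2.trans ht.2⟩ _
        (norm_hist_sub_le (hh s hs) (.of_continuousOn hyc ⟨hs.1, hs.2.trans ht.2⟩) hρ₀.le
          fun θ hθ => (h2 (s + θ) ⟨by linarith [hs.1, hθ.1], by linarith [hs.2, hθ.2]⟩).trans
            hρρ₀))
    have hst : ∀ s ∈ Icc 0 t, HasStep (fun s => F s (hist r x s)) x I μ δ s := by
      refine fun s hs => hstep s hs.1 ((hs.2.trans ht.2).trans hKL)
        ((Icc_subset_Icc_right hs.2).trans h1) fun p hp => ⟨?_, (hFM p ⟨hp.1,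
          hp.2.trans hs.2⟩).trans hKM⟩
      have hpt : p ∈ Icc (-r) t := ⟨by linarith [hp.1], hp.2.trans hs.2⟩
      have e1 := h2 p hpt
      have e2 := hB p ⟨hpt.1, hpt.2.trans ht.2⟩
      have e3 := norm_sub_norm_le (x p) (y p)
      linarith
    have hxt : ‖x t - y t‖ ≤ ρ / 3 := hclose x I μ t hμ ht hh
      (fun s hs => (hst s ⟨hs.1, hs.2.le⟩).mono hδδ₁) (fun s hs => hFM s ⟨hs.1, hs.2.le⟩)
      fun s hs => (hinit s hs).trans hδδ₁
    obtain ⟨t', k1, k2, k3, k4, -⟩ := hst t ⟨ht.1, le_rfl⟩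
    have htt' : t ≤ t' := by linarith
    have hI' : Icc 0 t' ⊆ I := by
      rw [← Icc_union_Icc_eq_Icc ht.1 htt']
      exact union_subset h1 k3
    -- The step may pass `L`, beyond which `y` is not controlled.
    have hnear : ∀ s ∈ Icc (-r) (min t' L), ‖x s - y s‖ ≤ ρ := by
      intro s hs
      rcases le_total s t with hst | hst
      · exact h2 s ⟨hs.1, hst⟩
      have hst' : s ≤ t' := hs.2.trans (min_le_left _ _)
      have e1 := k4 s ⟨hst, hst'⟩
      have e2 := Hh t ⟨by linarith [ht.1], ht.2⟩ s ⟨hs.1, hs.2.trans (min_le_right _ _)⟩ (by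
        rw [dist_comm, Real.dist_eq, abs_of_nonneg (by linarith)]
        linarith)
      rw [dist_eq_norm] at e2
      have e3 := norm_sub_le_norm_sub_add_norm_sub (x s) (x t) (y s)
      have e4 := norm_sub_le_norm_sub_add_norm_sub (x t) (y t) (y s)
      linarith
    rcases le_total t' L with hl | hl
    · rw [min_eq_left hl] at hnear
      exact ih t' ⟨ht.1.trans htt', hl⟩ (by push_cast at hLt; linarith) hI' hnear
    · rw [min_eq_right hl] at hnear
      exact ⟨(Icc_subset_Icc_right hl).trans hI', hnear⟩

/-! ### Transfer between germs and representatives -/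

section Transfer
variable {ι : Type*} {U : Ultrafilter ι} {V : Type*} [NormedAddCommGroup V]

/-- A universally quantified internal statement holds if it holds for all germs. -/
theorem eventually_forall_of_forall_germ {X : Type*} [Nonempty X] {p q : ι → X → Prop}
    (h : ∀ s : ι → X, (∀ᶠ i in U, p i (s i)) → ∀ᶠ i in U, q i (s i)) :
    ∀ᶠ i in U, ∀ s, p i s → q i s := by
  classical
  by_contra H
  rw [← Ultrafilter.eventually_not] at H
  -- A counterexample chosen at every index where one exists forms a germ that contradicts `h`.
  have hs : ∀ i, ∃ s, ¬ (∀ s, p i s → q i s) → p i s ∧ ¬ q i s := by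
    intro i
    by_cases hi : ∀ s, p i s → q i s
    · exact ⟨Classical.arbitrary X, fun h => absurd hi h⟩
    · push Not at hi
      obtain ⟨s, hs⟩ := hi
      exact ⟨s, fun _ => hs⟩
  choose s hs using hs
  obtain ⟨i, hi, hi'⟩ := (H.and (h s (H.mono fun i hi => (hs i hi).1))).exists
  exact (hs i hi).2 hi'

theorem infinitesimal_coe {v : ι → V} :
    Infinitesimal (v : Star U V) ↔ ∀ a : ℝ, 0 < a → ∀ᶠ i in U, ‖v i‖ < a :=
  forall₂_congr fun _ _ => Germ.coe_lt

theorem near_coe {u v : ι → V} :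
    Near (u : Star U V) (v : Star U V) ↔ ∀ a : ℝ, 0 < a → ∀ᶠ i in U, ‖u i - v i‖ < a :=
  infinitesimal_coe

theorem limited_coe {v : ι → V} :
    Limited (v : Star U V) ↔ ∃ a : ℝ, 0 < a ∧ ∀ᶠ i in U, ‖v i‖ ≤ a :=
  exists_congr fun _ => and_congr_right fun _ => Germ.coe_le

theorem iccSubset_coe {a b : ι → ℝ} {I : ι → Set ℝ} :
    IccSubset (a : Star U ℝ) (b : Star U ℝ) (I : Star U (Set ℝ)) ↔
      ∀ᶠ i in U, Icc (a i) (b i) ⊆ I i := by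
  constructor
  · intro h
    refine eventually_forall_of_forall_germ fun s hs => ?_
    exact h (s : Star U ℝ) (Germ.coe_le.2 (hs.mono fun _ h => h.1))
      (Germ.coe_le.2 (hs.mono fun _ h => h.2))
  · intro h s
    induction s using Germ.inductionOn with
    | _ s =>
    intro h1 h2
    filter_upwards [h, Germ.coe_le.1 h1, Germ.coe_le.1 h2] with i h h1 h2 using h ⟨h1, h2⟩

end Transfer

/-- The stroboscopic property in terms of representatives. -/
theorem Stroboscopic.eventually_hasStep [NormedSpace ℝ E] {ι : Type*} {U : Ultrafilter ι} {r : ℝ}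
    {F : ℝ → Hist r E → E} {I : ι → Set ℝ} {x : ι → ℝ → E}
    (h : Stroboscopic F (I : Star U (Set ℝ)) (x : Star U (ℝ → E))) :
    ∃ μ : ι → ℝ, (∀ᶠ i in U, 0 < μ i) ∧ ∀ K > 0, ∀ δ > 0, ∀ᶠ i in U, ∀ t,
      (0 ≤ t ∧ t ≤ K ∧ Icc 0 t ⊆ I i ∧
        ∀ s ∈ Icc 0 t, ‖x i s‖ ≤ K ∧ ‖F s (hist r (x i) s)‖ ≤ K) →
      HasStep (fun s => F s (hist r (x i) s)) (x i) (I i) (μ i) δ t := by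
  obtain ⟨μ, hμ, H⟩ := h
  induction μ using Germ.inductionOn with
  | _ μ =>
  -- One `μ` serves all `K` and `δ`. Bounds by the standard `K` make the germs limited, and `≃`
  -- yields accuracy `δ`.
  refine ⟨μ, Germ.coe_lt.1 hμ, fun K hK δ hδ => eventually_forall_of_forall_germ fun t ht => ?_⟩
  obtain ⟨t', -, h1, h2, h3, h4, h5⟩ := H (t : Star U ℝ)
    (limited_coe.2 ⟨K, hK, ht.mono fun i h => by
      rw [Real.norm_of_nonneg h.1]; exact h.2.1⟩)
    (Germ.coe_le.2 (ht.mono fun i h => h.1))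
    (ht.mono fun i h => h.2.2.1 ⟨h.1, le_rfl⟩)
    (iccSubset_coe.2 (ht.mono fun i h => h.2.2.1))
    (fun s => by
      induction s using Germ.inductionOn with
      | _ s =>
      intro h1 h2
      have h1' : ∀ᶠ i in U, 0 ≤ s i := Germ.coe_le.1 h1
      have h2' : ∀ᶠ i in U, s i ≤ t i := Germ.coe_le.1 h2
      have h3 := ht.and (h1'.and h2')
      exact ⟨limited_coe.2 ⟨K, hK, h3.mono fun i h => (h.1.2.2.2 (s i) h.2).1⟩,
        limited_coe.2 ⟨K, hK, h3.mono fun i h => (h.1.2.2.2 (s i) h.2).2⟩⟩)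
  induction t' using Germ.inductionOn with
  | _ t' =>
  have h4' : ∀ᶠ i in U, ∀ s, s ∈ Icc (t i) (t' i) → ‖x i s - x i (t i)‖ ≤ δ :=
    eventually_forall_of_forall_germ fun s hs =>
      (near_coe.1 (h4 (s : Star U ℝ) (Germ.coe_le.2 (hs.mono fun _ h => h.1))
        (Germ.coe_le.2 (hs.mono fun _ h => h.2))) δ hδ).mono fun _ h => h.le
  have h1' : ∀ᶠ i in U, μ i < t' i - t i := Germ.coe_lt.1 h1
  have h5' : ∀ᶠ i in U, ‖(t' i - t i)⁻¹ • (x i (t' i) - x i (t i)) -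
    F (t i) (hist r (x i) (t i))‖ < δ := near_coe.1 h5 δ hδ
  filter_upwards [h1', near_coe.1 h2 δ hδ, iccSubset_coe.1 h3, h4', h5'] with i k1 k2 k3 k4 k5
  exact ⟨t' i, k1, (le_abs_self _).trans k2.le, k3, k4, k5.le⟩

end Strobo

/-! ### The stroboscopic lemma -/

theorem theorem3p8
    -- the ultrapower in which the statement is read
    {ι : Type*} (U : Ultrafilter ι)
    -- the space `ℝ^d` with an arbitrary norm, and the delay `r ≥ 0`
    {E : Type*} [NormedAddCommGroup E] [NormedSpace ℝ E] [FiniteDimensional ℝ E]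
    (r : ℝ) (hr : 0 ≤ r)
    -- the standard data `φ` and `F`, with `F` continuous on `[0, ∞) × 𝒞`
    (φ : Strobo.Hist r E) (F : ℝ → Strobo.Hist r E → E)
    (hF : ContinuousOn (Function.uncurry F) (Set.Ici (0 : ℝ) ×ˢ Set.univ))
    -- the possibly nonstandard function `x : I → ℝ^d`
    (I : Strobo.Star U (Set ℝ)) (x : Strobo.Star U (ℝ → E))
    (hI : Strobo.IccSubset (↑(-r) : Strobo.Star U ℝ) 0 I)
    -- `x_t` is an element of `𝒞` for all `t ≥ 0` with `[0, t] ⊆ I`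
    (hx : ∀ t : Strobo.Star U ℝ, 0 ≤ t → Strobo.IccSubset 0 t I → Strobo.StarHasHist r x t)
    (hx0 : Strobo.Near (Strobo.starHist r x 0) (↑φ : Strobo.Star U (Strobo.Hist r E)))
    (ha : Strobo.Stroboscopic F I x)
    (y : ℝ → E) (ω : EReal) (hb : Strobo.IsUniqueSolution r F φ y ω)
    -- a standard positive `L` in `[-r, ω)`
    (L : ℝ) (hL : 0 < L) (hLω : (L : EReal) < ω) :
    Strobo.IccSubset (↑(-r) : Strobo.Star U ℝ) (↑L : Strobo.Star U ℝ) I ∧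
      ∀ t : Strobo.Star U ℝ, (↑(-r) : Strobo.Star U ℝ) ≤ t → t ≤ (↑L : Strobo.Star U ℝ) →
        Strobo.Near (Strobo.app x t) (t.map y) := by
  open Strobo Set in
  induction I using Germ.inductionOn with
  | _ I =>
  induction x using Germ.inductionOn with
  | _ x =>
  have hI' : ∀ᶠ i in U, Icc (-r) 0 ⊆ I i := iccSubset_coe.1 hI
  have hx' : ∀ᶠ i in U, ∀ t, (0 ≤ t ∧ Icc 0 t ⊆ I i) → HasHist r (x i) t :=
    eventually_forall_of_forall_germ fun t ht =>
      hx (t : Star U ℝ) (Germ.coe_le.2 (ht.mono fun _ h => h.1))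
        (iccSubset_coe.2 (ht.mono fun _ h => h.2))
  have hx0' : ∀ δ > 0, ∀ᶠ i in U, ‖hist r (x i) 0 - φ‖ < δ := near_coe.1 hx0
  obtain ⟨μ, hμ, hstep⟩ := ha.eventually_hasStep
  have hyh : HasHist r y 0 :=
    .of_continuousOn (hb.sol.continuousOn_Icc hLω) ⟨le_rfl, hL.le⟩
  have key : ∀ η > 0, ∀ᶠ i in U, Icc 0 L ⊆ I i ∧ ∀ s ∈ Icc (-r) L, ‖x i s - y s‖ ≤ η := by
    intro η hη
    obtain ⟨K, hK, δ, hδ, H⟩ := exists_forall_norm_sub_le hr hL.le hF hb hLω hη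
    -- For fixed `η` only finitely many conditions on the index are needed, so they hold together on
    -- a set of `U`.
    filter_upwards [hI', hx', hx0' δ hδ, hμ, hstep K hK δ hδ] with i k1 k2 k3 k4 k5
    have hxh : HasHist r (x i) 0 :=
      k2 0 ⟨le_rfl, (Icc_subset_Icc_left (by linarith)).trans k1⟩
    refine H (x i) (I i) (μ i) k4 k1 (fun t h1 h2 => k2 t ⟨h1, h2⟩) (fun s hs => ?_)
      fun t h1 h2 h3 h4 => k5 t ⟨h1, h2, h3, h4⟩
    have h := (ContinuousMap.norm_coe_le_norm (hist r (x i) 0 - φ) ⟨s, hs⟩).trans k3.le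
    rwa [← hb.sol.init, ContinuousMap.sub_apply, hist_apply hxh, hist_apply hyh, zero_add] at h
  refine ⟨iccSubset_coe.2 ?_, fun t => ?_⟩
  · filter_upwards [hI', key 1 one_pos] with i k1 k2
    rw [← Icc_union_Icc_eq_Icc (show -r ≤ 0 by linarith) hL.le]
    exact union_subset k1 k2.1
  · induction t using Germ.inductionOn with
    | _ t =>
    intro h1 h2
    refine near_coe.2 fun a ha => ?_
    filter_upwards [key (a / 2) (half_pos ha), Germ.coe_le.1 h1, Germ.coe_le.1 h2]
      with i k1 k2 k3
    exact (k1.2 (t i) ⟨k2, k3⟩).trans_lt (half_lt_self ha)
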